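/- All rings are associative with identity and all modules are unitary left modules. A ring $R$ is quasi-Frobenius if the projective $R$-modules and the injective $R$-modules coincide. Let $R\text{-mod}$ be the category of finitely presented $R$-modules, and let the stable module category $R\text{-}\underline{\mathrm{mod}}$ be the category with the same objects whose morphisms are the morphisms of $R\text{-mod}$ modulo those factoring through a finitely presented projective module. A quasi-projective resolution of an $R$-module $M$ is a bounded below complex $P_\bullet=(P_i,\,d_i:P_i\to P_{i-1})_{i\in\mathbb Z}$ of projective $R$-modules such that for each $j$ there is an integer $n_j\ge 0$ with $H_j(P_\bullet)\cong M^{n_j}$, where the $n_j$ are not all zero; it is finite if $P_\bullet$ is bounded. For $M\neq 0$ put $$\operatorname{qpd}_R M=\inf\{\sup P_\bullet-\operatorname{hsup}P_\bullet \mid P_\bullet\text{ a finite quasi-projective resolution of }M\}\in\mathbb N\cup\{\infty\},$$ where $\sup P_\bullet=\sup\{i\mid P_i\ne 0\}$, $\operatorname{hsup}P_\bullet=\sup\{i\mid H_i(P_\bullet)\neq 0\}$ and $\inf\emptyset=\infty$; put $\operatorname{qpd}_R 0=0$. The quasi-global dimension of $R$ is $\operatorname{qgldim} R=\sup\{\operatorname{qpd}_R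 M\mid M\in R\text{-mod}\}$. **Proposition.** Let $A$ and $B$ be quasi-Frobenius rings, and let $F:A\text{-mod}\to B\text{-mod}$ be an exact functor that induces an equivalence $A\text{-}\underline{\mathrm{mod}}\to B\text{-}\underline{\mathrm{mod}}$ of stable module categories. Then $\operatorname{qgldim} B\le\operatorname{qgldim} A$. -/

import Mathlib

open CategoryTheory CategoryTheory.Limits

universe v u

section QuasiProjectiveDimension

attribute [local instance] Abelian.hasFiniteBiproducts

variable {C : Type u} [Category.{v} C] [Abelian C]

/-- `P` is a quasi-projective resolution of `M`: a bounded below complex of projective objects,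
with differentials `P_{i+1} ⟶ P_i` for `i : ℤ`, whose homology objects are finite direct sums
`H_j(P) ≅ M ^ n_j` of copies of `M`, where the natural numbers `n_j` are not all zero.
(In degrees below `inf P` the homology vanishes, so that `n_j = 0` there as soon as `M ≠ 0`.) -/
structure IsQuasiProjectiveResolution (M : C) (P : ChainComplex C ℤ) : Prop where
  boundedBelow : ∃ m : ℤ, ∀ i < m, IsZero (P.X i)
  projective : ∀ i : ℤ, Projective (P.X i)
  homology_iso : ∃ n : ℤ → ℕ, (∃ j, n j ≠ 0) ∧
    ∀ j, Nonempty (P.homology j ≅ ⨁ (fun _ : Fin (n j) => M))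

/-- `s = sup P` is the largest degree in which the complex `P` is nonzero
(in particular `P` is then bounded above). -/
def IsSupOf (P : ChainComplex C ℤ) (s : ℤ) : Prop :=
  IsGreatest {i : ℤ | ¬ IsZero (P.X i)} s

/-- `h = hsup P` is the largest degree in which the homology of the complex `P` is nonzero. -/
def IsHSupOf (P : ChainComplex C ℤ) (h : ℤ) : Prop :=
  IsGreatest {i : ℤ | ¬ IsZero (P.homology i)} h

open Classical in
/-- The quasi-projective dimension of `M`: the infimum of `sup P - hsup P` over all finite (that
is, bounded) quasi-projective resolutions `P` of `M`, with value `∞` if there are none;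
it is `0` for the zero object. For `M ≠ 0` both suprema of a finite quasi-projective resolution
are attained, and `hsup P ≤ sup P`. -/
noncomputable def qpdim (M : C) : ℕ∞ :=
  if IsZero M then 0
  else sInf {d : ℕ∞ | ∃ (P : ChainComplex C ℤ) (s h : ℤ) (k : ℕ),
    IsQuasiProjectiveResolution M P ∧ IsSupOf P s ∧ IsHSupOf P h ∧ s - h = k ∧ d = k}

end QuasiProjectiveDimension

section Rings

variable (R : Type u) [Ring R]

/-- A ring is quasi-Frobenius if its projective left modules and its injective left modules are
the same. -/
def IsQuasiFrobenius : Prop :=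
  ∀ (M : Type u) [AddCommGroup M] [Module R M], Module.Projective R M ↔ Module.Injective R M

/-- `R-mod`, the category of finitely presented left `R`-modules, as a full subcategory of the
category of all left `R`-modules. -/
abbrev FPModuleCat : Type (u + 1) :=
  ObjectProperty.FullSubcategory
    (fun M : ModuleCat.{u} R => Module.FinitePresentation R M)

/-- The quasi-global dimension of `R`: the supremum of the quasi-projective dimensions, in the
category of all left `R`-modules, of the finitely presented left `R`-modules. -/
noncomputable def qgldim : ℕ∞ :=
  ⨆ M : FPModuleCat R, qpdim M.obj

/-- Two morphisms of `R-mod` are stably equal if their difference factors through a finitely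
presented projective module. -/
def stableRel : HomRel (FPModuleCat R) := fun X Y f g =>
  ∃ (Q : FPModuleCat R) (a : X ⟶ Q) (b : Q ⟶ Y), Module.Projective R Q.obj ∧ f - g = a ≫ b

/-- The stable module category of `R`: the objects are those of `R-mod`, the morphisms are those of
`R-mod` modulo the ones that factor through a projective module. -/
abbrev StableModuleCat : Type (u + 1) :=
  CategoryTheory.Quotient (stableRel R)

/-- Stable equality is a congruence, so that the morphisms of the stable category are exactly the
classes of stably equal morphisms. -/
theorem stableRel_congruence : Congruence (stableRel R) where
  comp_left := by
    rintro X Y Z f g g' ⟨Q, a, b, hQ, h⟩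
    exact ⟨Q, f ≫ a, b, hQ, by rw [← Preadditive.comp_sub, h, Category.assoc]⟩
  comp_right := by
    rintro X Y Z f f' g ⟨Q, a, b, hQ, h⟩
    exact ⟨Q, a, b ≫ g, hQ, by rw [← Preadditive.sub_comp, h, Category.assoc]⟩
  equivalence := by
    intro X Y
    refine ⟨fun f => ?_, ?_, ?_⟩
    · exact ⟨⟨ModuleCat.of R PUnit.{u + 1}, inferInstanceAs (Module.FinitePresentation R PUnit.{u + 1})⟩,
        0, 0, inferInstanceAs (Module.Projective R PUnit.{u + 1}), by simp⟩
    · rintro f g ⟨Q, a, b, hQ, h⟩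
      exact ⟨Q, -a, b, hQ, by rw [Preadditive.neg_comp, ← h, neg_sub]⟩
    · rintro f g k ⟨Q, a, b, hQ, h⟩ ⟨Q', a', b', hQ', h'⟩
      have := Q.property
      have := Q'.property
      refine ⟨⟨ModuleCat.of R (Q.obj × Q'.obj),
          inferInstanceAs (Module.FinitePresentation R (Q.obj × Q'.obj))⟩,
        ObjectProperty.homMk (ModuleCat.ofHom (a.hom.hom.prod a'.hom.hom)),
        ObjectProperty.homMk (ModuleCat.ofHom (b.hom.hom.coprod b'.hom.hom)),
        inferInstanceAs (Module.Projective R (Q.obj × Q'.obj)), ?_⟩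
      rw [← sub_add_sub_cancel f g k, h, h']
      ext x
      rfl

end Rings

section Functors

universe w

variable {A : Type u} [Ring A] {B : Type w} [Ring B]

/-- A functor `A-mod ⥤ B-mod` is exact if it maps every short exact sequence
`0 ⟶ X ⟶ Y ⟶ Z ⟶ 0` to a short exact sequence. -/
def IsExactFunctor (F : FPModuleCat A ⥤ FPModuleCat B) : Prop :=
  ∀ ⦃X Y Z : FPModuleCat A⦄ (f : X ⟶ Y) (g : Y ⟶ Z),
    Function.Injective f.hom.hom → Function.Exact f.hom.hom g.hom.hom →
    Function.Surjective g.hom.hom →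
      Function.Injective (F.map f).hom.hom ∧
      Function.Exact (F.map f).hom.hom (F.map g).hom.hom ∧
      Function.Surjective (F.map g).hom.hom

/-- `F` induces an equivalence of stable module categories: it respects stable equality of
morphisms, and the induced functor between the stable module categories is an equivalence. -/
def InducesStableEquivalence (F : FPModuleCat A ⥤ FPModuleCat B) : Prop :=
  ∃ hF : ∀ (X Y : FPModuleCat A) (f g : X ⟶ Y),
      stableRel A f g → stableRel B (F.map f) (F.map g),
    (CategoryTheory.Quotient.lift (stableRel A)
      (F ⋙ CategoryTheory.Quotient.functor (stableRel B))
      (fun X Y f g h => CategoryTheory.Quotient.sound (stableRel B) (hF X Y f g h)) :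
        StableModuleCat A ⥤ StableModuleCat B).IsEquivalence

end Functors

-- Essential surjectivity of the stable functor gives, for `M` over `B`, a module `N` over `A` with
-- `F N` stably isomorphic to `M`, hence `F N ⊕ Q ≅ M ⊕ W` with `Q` and `W` projective
-- (`exists_prod_equiv_of_stable_iso`). It remains to turn a finite quasi-projective resolution `P`
-- of `N`, with homology `N ^ n_j`, into one of `M` in the same range of degrees and with the same
-- exponents.
--
-- Since `F` is defined only on finitely presented modules, `P` must first be made degreewise
-- finitely generated without becoming longer (`IsBoundedProjective.exists_finite`). This is
-- possible because a quasi-Frobenius ring is Noetherian. Then `F`, being exact and preserving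
-- projectives, yields homology `(F N) ^ n_j` (`IsBoundedProjective.exists_map`). Adding `Q ^ n_j`
-- with zero differential changes the homology to `M ^ n_j ⊕ W ^ n_j`. Over `B` the projective
-- module `W ^ n_j` is also injective, so it lifts to a direct summand of the complex consisting of
-- cycles and can be divided out (`IsBoundedProjective.exists_of_prod`).

universe w

/-! ### Quasi-Frobenius rings are Noetherian -/

section Noetherian

variable {R : Type u} [Ring R]

/-- Bass: if arbitrary direct sums of copies of injective modules are injective, then `R` is left
Noetherian. -/
theorem isNoetherianRing_of_injective_finsupp
    (h : ∀ (E : Type u) [AddCommGroup E] [Module R E], Module.Injective R E →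
      Module.Injective R (ℕ →₀ E)) : IsNoetherianRing R := by
  rw [isNoetherianRing_iff, ← monotone_stabilizes_iff_noetherian]
  intro f
  obtain ⟨⟨E, hE, i, hi⟩⟩ :=
    EnoughInjectives.presentation (ModuleCat.of R (∀ n : ℕ, R ⧸ f n))
  have hE' : Module.Injective R E := Module.injective_module_of_injective_object R E
  have hi' : Function.Injective i.hom := (ModuleCat.mono_iff_injective i).1 hi
  let ψ (n : ℕ) : R →ₗ[R] E :=
    i.hom ∘ₗ LinearMap.single R (fun n => R ⧸ f n) n ∘ₗ (f n).mkQ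
  have hψ (n : ℕ) (x : R) : ψ n x = 0 ↔ x ∈ f n := by
    have h0 : ψ n x = i.hom (Pi.single n ((f n).mkQ x)) := rfl
    rw [h0, map_eq_zero_iff _ hi', Pi.single_eq_zero_iff]
    simp
  let I : Submodule R R := ⨆ n, f n
  have hI (x : R) (hx : x ∈ I) : ∃ m, x ∈ f m :=
    (Submodule.mem_iSup_of_directed _ f.monotone.directed_le).1 hx
  have hfin (x : I) : (Function.support fun n => ψ n x).Finite := by
    obtain ⟨m, hm⟩ := hI x x.2
    refine (Set.finite_lt_nat m).subset fun n hn => ?_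
    by_contra hmn
    exact hn ((hψ n x).2 (f.monotone (not_lt.1 hmn) hm))
  -- An extension of this map to `R` is determined by its value at 1, which has finite support. In a
  -- degree beyond that support the component vanishes on all of `I`, which says that the chain has
  -- stopped growing.
  let φ : I →ₗ[R] (ℕ →₀ E) :=
    { toFun := fun x => Finsupp.ofSupportFinite (fun n => ψ n x) (hfin x)
      map_add' := fun x y => by ext n; exact (ψ n).map_add x y
      map_smul' := fun r x => by ext n; exact (ψ n).map_smul r x }
  obtain ⟨g, hg⟩ := (h E hE').out I.subtype I.injective_subtype φ
  obtain ⟨m, hm⟩ := (g 1).support.finite_toSet.bddAbove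
  refine ⟨m + 1, fun n hn => le_antisymm (f.monotone hn) fun x hx => ?_⟩
  have hxI : x ∈ I := Submodule.mem_iSup_of_mem n hx
  rw [← hψ]
  have h1 : g x (m + 1) = ψ (m + 1) x := DFunLike.congr_fun (hg ⟨x, hxI⟩) (m + 1)
  have h2 : g 1 (m + 1) = 0 := by
    by_contra hne
    have := hm (Finsupp.mem_support_iff.2 hne)
    omega
  rw [← h1, ← mul_one x, ← smul_eq_mul, map_smul, Finsupp.smul_apply, h2, smul_zero]

theorem IsQuasiFrobenius.isNoetherianRing (hR : IsQuasiFrobenius R) : IsNoetherianRing R := by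
  refine isNoetherianRing_of_injective_finsupp fun E _ _ hE => ?_
  have : Module.Projective R E := (hR E).2 hE
  classical
  exact (hR _).1 (Module.Projective.of_equiv (finsuppLequivDFinsupp (M := E) R).symm)

end Noetherian

/-! ### Homology of complexes of modules, by elements -/

section Homology

variable {R : Type u} [Ring R]

/-- The module `H` is the homology in degree `j` of the complex `P`, witnessed by a module `T`
which maps onto the cycles and onto `H` in a compatible way. -/
def HasHomology (P : ChainComplex (ModuleCat.{u} R) ℤ) (j : ℤ) (H : Type u) [AddCommGroup H]
    [Module R H] : Prop :=
  ∃ (T : ModuleCat.{u} R) (a : T →ₗ[R] P.X j) (p : T →ₗ[R] H),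
    (∀ x, (P.d j (j - 1)).hom x = 0 ↔ ∃ t, a t = x) ∧ Function.Surjective p ∧
    ∀ t, p t = 0 ↔ ∃ y, (P.d (j + 1) j).hom y = a t

variable {P : ChainComplex (ModuleCat.{u} R) ℤ} {j : ℤ}

theorem d_apply_d_apply (P : ChainComplex (ModuleCat.{u} R) ℤ) (i j k : ℤ) (x : P.X i) :
    (P.d j k).hom ((P.d i j).hom x) = 0 := by
  have := P.d_comp_d i j k
  exact congrArg (fun f => f.hom x) this

/-- The boundaries in degree `j` as a submodule of the cycles. -/
def boundaries (P : ChainComplex (ModuleCat.{u} R) ℤ) (j : ℤ) :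
    Submodule R (LinearMap.ker (P.d j (j - 1)).hom) :=
  LinearMap.range ((P.d (j + 1) j).hom.codRestrict (LinearMap.ker (P.d j (j - 1)).hom)
    fun y => d_apply_d_apply P (j + 1) j (j - 1) y)

theorem mem_boundaries_iff (x : LinearMap.ker (P.d j (j - 1)).hom) :
    x ∈ boundaries P j ↔ ∃ y, (P.d (j + 1) j).hom y = x.1 :=
  ⟨fun ⟨y, hy⟩ => ⟨y, congrArg Subtype.val hy⟩, fun ⟨y, hy⟩ => ⟨y, Subtype.ext hy⟩⟩

/-- The homology of a complex of modules as cycles modulo boundaries. -/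
noncomputable def homologyIsoCycles (P : ChainComplex (ModuleCat.{u} R) ℤ) (j : ℤ) :
    P.homology j ≅ ModuleCat.of R (LinearMap.ker (P.d j (j - 1)).hom ⧸ boundaries P j) :=
  P.homologyIsoSc' (j + 1) j (j - 1) (by simp) (by simp) ≪≫
    (P.sc' (j + 1) j (j - 1)).moduleCatHomologyIso

/-- Two modules that receive surjections with the same kernel are isomorphic. -/
noncomputable def equivOfKerEq {T H H' : Type*} [AddCommGroup T] [Module R T] [AddCommGroup H]
    [Module R H] [AddCommGroup H'] [Module R H'] (p : T →ₗ[R] H) (q : T →ₗ[R] H')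
    (hp : Function.Surjective p) (hq : Function.Surjective q) (h : ∀ t, p t = 0 ↔ q t = 0) :
    H ≃ₗ[R] H' :=
  (p.quotKerEquivOfSurjective hp).symm ≪≫ₗ
    Submodule.quotEquivOfEq _ _ (by ext t; exact h t) ≪≫ₗ q.quotKerEquivOfSurjective hq

theorem exists_surjective_of_iso {H : Type u} [AddCommGroup H] [Module R H]
    (e : P.homology j ≅ ModuleCat.of R H) : ∃ p : LinearMap.ker (P.d j (j - 1)).hom →ₗ[R] H,
      Function.Surjective p ∧ ∀ z, p z = 0 ↔ ∃ y, (P.d (j + 1) j).hom y = z.1 := by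
  let e' := (homologyIsoCycles P j).symm ≪≫ e
  refine ⟨e'.toLinearEquiv.toLinearMap ∘ₗ Submodule.mkQ _, ?_, fun t => ?_⟩
  · exact e'.toLinearEquiv.surjective.comp (Submodule.mkQ_surjective _)
  · rw [LinearMap.comp_apply, LinearEquiv.coe_coe, LinearEquiv.map_eq_zero_iff,
      Submodule.mkQ_apply, Submodule.Quotient.mk_eq_zero]
    exact mem_boundaries_iff t

/-- The map from `T` to cycles modulo boundaries is onto and has the same kernel as `p`. Leaving `T`
free allows the witness to be carried along when the complex is modified. -/
theorem hasHomology_iff {H : Type u} [AddCommGroup H] [Module R H] :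
    HasHomology P j H ↔ Nonempty (P.homology j ≅ ModuleCat.of R H) := by
  constructor
  · rintro ⟨T, a, p, ha, hp, hk⟩
    let a' : T →ₗ[R] LinearMap.ker (P.d j (j - 1)).hom :=
      a.codRestrict _ fun t => (ha _).2 ⟨t, rfl⟩
    refine ⟨homologyIsoCycles P j ≪≫ (equivOfKerEq
      ((boundaries P j).mkQ ∘ₗ a') p ?_ hp
        ?_).toModuleIso⟩
    · refine (Submodule.mkQ_surjective _).comp ?_
      rintro ⟨x, hx⟩
      obtain ⟨t, rfl⟩ := (ha x).1 hx
      exact ⟨t, rfl⟩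
    · intro t
      rw [hk, LinearMap.comp_apply, Submodule.mkQ_apply, Submodule.Quotient.mk_eq_zero]
      exact mem_boundaries_iff (a' t)
  · rintro ⟨e⟩
    obtain ⟨p, hp, hk⟩ := exists_surjective_of_iso e
    exact ⟨ModuleCat.of R (LinearMap.ker (P.d j (j - 1)).hom), Submodule.subtype _, p,
      fun x => ⟨fun hx => ⟨⟨x, hx⟩, rfl⟩, fun ⟨t, ht⟩ => ht ▸ t.2⟩, hp, hk⟩

theorem HasHomology.exists_surjective {H : Type u} [AddCommGroup H] [Module R H]
    (h : HasHomology P j H) : ∃ p : LinearMap.ker (P.d j (j - 1)).hom →ₗ[R] H,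
      Function.Surjective p ∧ ∀ z, p z = 0 ↔ ∃ y, (P.d (j + 1) j).hom y = z.1 :=
  exists_surjective_of_iso (hasHomology_iff.1 h).some

theorem HasHomology.congr {H H' : Type u} [AddCommGroup H] [Module R H] [AddCommGroup H']
    [Module R H'] (h : HasHomology P j H) (e : H ≃ₗ[R] H') : HasHomology P j H' := by
  rw [hasHomology_iff] at h ⊢
  exact h.map fun f => f ≪≫ e.toModuleIso

/-- A chain complex of modules from a family of linear maps. -/
def moduleComplex (X : ℤ → Type u) [∀ i, AddCommGroup (X i)] [∀ i, Module R (X i)]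
    (d : ∀ i j, X i →ₗ[R] X j) (shape : ∀ i j, i ≠ j + 1 → d i j = 0)
    (sq : ∀ i j k x, d j k (d i j x) = 0) : ChainComplex (ModuleCat.{u} R) ℤ where
  X i := ModuleCat.of R (X i)
  d i j := ModuleCat.ofHom (d i j)
  shape i j h := by
    rw [shape i j fun h' => h h'.symm]
    rfl
  d_comp_d' i j k _ _ := by
    ext x
    exact sq i j k x

theorem d_eq_zero_of_ne (P : ChainComplex (ModuleCat.{u} R) ℤ) {i j : ℤ} (h : i ≠ j + 1) :
    (P.d i j).hom = 0 := by
  rw [P.shape i j fun h' => h h'.symm]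
  rfl

theorem hasHomology_moduleComplex {X : ℤ → Type u} [∀ i, AddCommGroup (X i)]
    [∀ i, Module R (X i)] {d : ∀ i j, X i →ₗ[R] X j} {shape : ∀ i j, i ≠ j + 1 → d i j = 0}
    {sq : ∀ i j k x, d j k (d i j x) = 0} {H : Type u} [AddCommGroup H] [Module R H]
    {T : Type u} [AddCommGroup T] [Module R T] (a : T →ₗ[R] X j) (p : T →ₗ[R] H)
    (ha : ∀ x, d j (j - 1) x = 0 ↔ ∃ t, a t = x) (hp : Function.Surjective p)
    (hk : ∀ t, p t = 0 ↔ ∃ y, d (j + 1) j y = a t) :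
    HasHomology (moduleComplex X d shape sq) j H :=
  ⟨ModuleCat.of R T, a, p, ha, hp, hk⟩

end Homology

/-! ### Adding and removing projective summands of homology -/

section Summands

variable {R : Type u} [Ring R]

/-- A complex of projective modules concentrated in degrees `b ≤ j ≤ s`. -/
structure IsBoundedProjective (P : ChainComplex (ModuleCat.{u} R) ℤ) (b s : ℤ) : Prop where
  projective : ∀ j, Module.Projective R (P.X j)
  subsingleton : ∀ j, j < b ∨ s < j → Subsingleton (P.X j)

variable {P : ChainComplex (ModuleCat.{u} R) ℤ} {b s : ℤ}
  {H : ℤ → Type u} [∀ j, AddCommGroup (H j)] [∀ j, Module R (H j)]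
  {W : ℤ → Type u} [∀ j, AddCommGroup (W j)] [∀ j, Module R (W j)]

/-- Projective modules can be added to the homology of a complex of projective modules. -/
theorem IsBoundedProjective.exists_prod (hP : IsBoundedProjective P b s)
    (hH : ∀ j, HasHomology P j (H j)) (hW : ∀ j, Module.Projective R (W j))
    (hW' : ∀ j, j < b ∨ s < j → Subsingleton (W j)) :
    ∃ P' : ChainComplex (ModuleCat.{u} R) ℤ, IsBoundedProjective P' b s ∧
      ∀ j, HasHomology P' j (H j × W j) := by
  have := hP.projective
  refine ⟨moduleComplex (fun j => P.X j × W j)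
    (fun i j => LinearMap.inl R (P.X j) (W j) ∘ₗ (P.d i j).hom ∘ₗ LinearMap.fst R (P.X i) (W i))
    ?_ ?_, ⟨?_, ?_⟩, ?_⟩
  · intro i j h
    rw [d_eq_zero_of_ne P h, LinearMap.zero_comp, LinearMap.comp_zero]
  · intro i j k x
    exact Prod.ext (d_apply_d_apply P i j k x.1) rfl
  · exact fun j => inferInstanceAs (Module.Projective R (P.X j × W j))
  · intro j hj
    have := hP.subsingleton j hj
    have := hW' j hj
    exact inferInstanceAs (Subsingleton (P.X j × W j))
  · intro j
    obtain ⟨T, a, p, ha, hp, hk⟩ := hH j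
    refine hasHomology_moduleComplex (a.prodMap LinearMap.id) (p.prodMap LinearMap.id) ?_ ?_ ?_
    · rintro ⟨x, w⟩
      constructor
      · intro h
        obtain ⟨t, rfl⟩ := (ha x).1 (congrArg Prod.fst h)
        exact ⟨(t, w), rfl⟩
      · rintro ⟨⟨t, w'⟩, h⟩
        exact Prod.ext ((ha x).2 ⟨t, congrArg Prod.fst h⟩) rfl
    · rintro ⟨h, w⟩
      obtain ⟨t, rfl⟩ := hp h
      exact ⟨(t, w), rfl⟩
    · rintro ⟨t, w⟩
      constructor
      · intro h
        obtain ⟨y, hy⟩ := (hk t).1 (congrArg Prod.fst h)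
        exact ⟨(y, 0), Prod.ext hy (congrArg Prod.snd h).symm⟩
      · rintro ⟨⟨y, w'⟩, h⟩
        exact Prod.ext ((hk t).2 ⟨y, congrArg Prod.fst h⟩) (congrArg Prod.snd h).symm

/-- Modules that are both projective and injective can be removed from the homology of a complex
of projective modules. -/
theorem IsBoundedProjective.exists_of_prod (hP : IsBoundedProjective P b s)
    (hH : ∀ j, HasHomology P j (H j × W j)) (hW : ∀ j, Module.Projective R (W j))
    (hW' : ∀ j, Module.Injective R (W j)) :
    ∃ P' : ChainComplex (ModuleCat.{u} R) ℤ, IsBoundedProjective P' b s ∧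
      ∀ j, HasHomology P' j (H j) := by
  have := hP.projective
  choose T a p ha hp hk using hH
  -- Projectivity lifts `W j` from the homology to cycles. The lift `σ j` below meets the boundaries
  -- only in zero, so it is injective.
  have hτ (j) : ∃ τ : W j →ₗ[R] T j, p j ∘ₗ τ = LinearMap.inr R (H j) (W j) :=
    Module.projective_lifting_property _ _ (hp j)
  choose τ hτ using hτ
  have hτ' (j) (w : W j) : p j (τ j w) = (0, w) := LinearMap.congr_fun (hτ j) w
  let σ (j) : W j →ₗ[R] P.X j := a j ∘ₗ τ j
  -- The source degree `i` is arbitrary so that this applies both to `d (j + 1) j` and to `d j (j -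
  -- 1)` without casts.
  have hσ (i j) (w : W j) (y : P.X i) (h : (P.d i j).hom y = σ j w) : w = 0 := by
    have : p j (τ j w) = 0 := by
      refine (hk j (τ j w)).2 ?_
      by_cases hij : i = j + 1
      · subst hij
        exact ⟨y, h⟩
      · rw [d_eq_zero_of_ne P hij, LinearMap.zero_apply] at h
        exact ⟨0, by rw [map_zero, h]; rfl⟩
    rw [hτ'] at this
    exact congrArg Prod.snd this
  have hσinj (j) : Function.Injective (σ j) :=
    (injective_iff_map_eq_zero _).2 fun w h => hσ j j w 0 (by rw [h, map_zero])
  have hσd (i j) (w : W i) : (P.d i j).hom (σ i w) = 0 := by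
    by_cases h : i = j + 1
    · obtain rfl : j = i - 1 := by omega
      exact (ha i _).2 ⟨_, rfl⟩
    · rw [d_eq_zero_of_ne P h, LinearMap.zero_apply]
  have hd (i j) : LinearMap.range (σ i) ≤ (LinearMap.range (σ j)).comap (P.d i j).hom := by
    rintro _ ⟨w, rfl⟩
    exact ⟨0, by rw [map_zero, hσd]⟩
  refine ⟨moduleComplex (fun j => P.X j ⧸ LinearMap.range (σ j))
    (fun i j => Submodule.mapQ _ _ (P.d i j).hom (hd i j)) ?_ ?_, ⟨?_, ?_⟩, ?_⟩
  · intro i j h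
    ext x
    simp [d_eq_zero_of_ne P h]
  · intro i j k x
    induction x using Submodule.Quotient.induction_on with
    | H x => simp [d_apply_d_apply]
  · intro j
    -- Injectivity of `W j` splits `σ j`, so the quotient is a direct summand of a projective
    -- module.
    obtain ⟨r, hr⟩ := (hW' j).out (σ j) (hσinj j) LinearMap.id
    change Module.Projective R (P.X j ⧸ LinearMap.range (σ j))
    refine Module.Projective.of_split (M := P.X j)
      ((LinearMap.range (σ j)).liftQ (LinearMap.id - σ j ∘ₗ r) ?_)
      (LinearMap.range (σ j)).mkQ ?_
    · rintro _ ⟨w, rfl⟩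
      simp [hr]
    · ext x
      have : Submodule.Quotient.mk (p := LinearMap.range (σ j)) (σ j (r x)) = 0 :=
        (Submodule.Quotient.mk_eq_zero _).2 ⟨_, rfl⟩
      simp [this]
  · intro j hj
    have := hP.subsingleton j hj
    exact (Submodule.mkQ_surjective (LinearMap.range (σ j))).subsingleton
  · intro j
    refine hasHomology_moduleComplex ((LinearMap.range (σ j)).mkQ ∘ₗ a j)
      (LinearMap.fst R (H j) (W j) ∘ₗ p j) ?_ (Prod.fst_surjective.comp (hp j)) ?_
    · intro x
      obtain ⟨x, rfl⟩ := Submodule.mkQ_surjective _ x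
      constructor
      · intro h
        obtain ⟨w, hw⟩ := (Submodule.Quotient.mk_eq_zero _).1 h
        have hw0 : w = 0 := hσ _ _ w x hw.symm
        rw [hw0, map_zero] at hw
        obtain ⟨t, rfl⟩ := (ha j x).1 hw.symm
        exact ⟨t, rfl⟩
      · rintro ⟨t, ht⟩
        rw [← ht]
        refine (Submodule.Quotient.mk_eq_zero _).2 ⟨0, ?_⟩
        rw [map_zero]
        exact ((ha j _).2 ⟨t, rfl⟩).symm
    · intro t
      constructor
      · intro h
        -- Subtracting the lifted `W`-component of the class leaves an honest boundary.
        have h0 : p j (t - τ j (p j t).2) = 0 := by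
          rw [map_sub, hτ', sub_eq_zero]
          exact Prod.ext h rfl
        obtain ⟨y, hy⟩ := (hk j _).1 h0
        refine ⟨(LinearMap.range (σ (j + 1))).mkQ y, (Submodule.Quotient.eq _).2 ?_⟩
        refine ⟨-(p j t).2, ?_⟩
        rw [hy, map_sub, map_neg]
        exact (sub_sub_cancel_left _ _).symm
      · rintro ⟨y, hy⟩
        obtain ⟨y, rfl⟩ := Submodule.mkQ_surjective _ y
        obtain ⟨w, hw⟩ := (Submodule.Quotient.eq _).1 hy
        have h0 : p j (t + τ j w) = 0 := by
          refine (hk j _).2 ⟨y, ?_⟩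
          rw [map_add]
          exact (add_eq_of_eq_sub' hw).symm
        rw [map_add, hτ'] at h0
        have := congrArg Prod.fst h0
        rwa [Prod.fst_add, add_zero] at this

end Summands

/-! ### Replacing a complex by one with finitely generated terms -/

section FiniteGeneration

variable {R : Type u} [Ring R] {P : ChainComplex (ModuleCat.{u} R) ℤ} {b s : ℤ}

/-- The differential on `P_j / B_j` has kernel isomorphic to `H`, and its image lies in the
Noetherian module `P_{j-1}`; both are finitely generated. -/
theorem HasHomology.finite_quotient_range [IsNoetherianRing R] {j : ℤ} {H : Type u}
    [AddCommGroup H] [Module R H] (h : HasHomology P j H) [Module.Finite R H]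
    [Module.Finite R (P.X (j - 1))] :
    Module.Finite R (P.X j ⧸ LinearMap.range (P.d (j + 1) j).hom) := by
  obtain ⟨T, a, p, ha, hp, hk⟩ := h
  let B := LinearMap.range (P.d (j + 1) j).hom
  let f : (P.X j ⧸ B) →ₗ[R] P.X (j - 1) := B.liftQ (P.d j (j - 1)).hom (by
    rintro _ ⟨y, rfl⟩
    exact d_apply_d_apply P _ _ _ y)
  have hker : LinearMap.ker f = LinearMap.range (B.mkQ ∘ₗ a) := by
    ext x
    obtain ⟨x, rfl⟩ := Submodule.mkQ_surjective _ x
    constructor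
    · intro h
      obtain ⟨t, rfl⟩ := (ha x).1 h
      exact ⟨t, rfl⟩
    · rintro ⟨t, ht⟩
      rw [← ht]
      exact (ha _).2 ⟨t, rfl⟩
  have hfin : (LinearMap.range (B.mkQ ∘ₗ a)).FG := by
    rw [← Module.Finite.iff_fg]
    refine Module.Finite.equiv (equivOfKerEq p (B.mkQ ∘ₗ a).rangeRestrict hp
      (LinearMap.surjective_rangeRestrict _) fun t => ?_)
    rw [hk]
    refine ((Submodule.Quotient.mk_eq_zero B).symm).trans ?_
    exact ⟨fun h => Subtype.ext h, fun h => congrArg Subtype.val h⟩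
  refine ⟨Submodule.fg_of_fg_map_of_fg_inf_ker f (IsNoetherian.noetherian _) ?_⟩
  rw [top_inf_eq, hker]
  exact hfin

/-- In a complex of projective modules, the term in degree `i` can be replaced by a projective
module `Q` which, together with the boundaries, covers it. Only the term in degree `i + 1` changes
besides. -/
theorem IsBoundedProjective.exists_replace (hP : IsBoundedProjective P b s) {i : ℤ} (hb : b ≤ i)
    (hs : i < s) (Q : Type u) [AddCommGroup Q] [Module R Q] [Module.Projective R Q]
    (q₀ : Q →ₗ[R] P.X i) (hq₀ : ∀ x, ∃ y z, (P.d (i + 1) i).hom y + q₀ z = x) :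
    ∃ P' : ChainComplex (ModuleCat.{u} R) ℤ, IsBoundedProjective P' b s ∧
      (∀ (j : ℤ) (H : Type u) [AddCommGroup H] [Module R H],
        HasHomology P j H → HasHomology P' j H) ∧
      Nonempty (P'.X i ≃ₗ[R] Q) ∧ ∀ j < i, Nonempty (P'.X j ≃ₗ[R] P.X j) := by
  have := hP.projective
  -- Only `q i` matters; a family over all degrees avoids transporting `q₀` along equalities of
  -- degrees.
  let q : ∀ j, Q →ₗ[R] P.X j := Pi.single i q₀
  have hq (x : P.X i) : ∃ y z, (P.d (i + 1) i).hom y + q i z = x := by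
    rw [show q i = q₀ from Pi.single_eq_same (M := fun j => Q →ₗ[R] P.X j) i q₀]
    exact hq₀ x
  clear_value q
  -- The new terms: the graph of `q`, a copy of `Q`, in degree `i`; the pullback of `P_{i+1}` and
  -- `Q` over `P_i` in degree `i + 1`; and `P_j × 0` elsewhere. Projection to `P` will be a
  -- quasi-isomorphism.
  let C (j : ℤ) : Submodule R (P.X j × Q) :=
    { carrier := {v | (j = i + 1 → (P.d j i).hom v.1 = q i v.2) ∧ (j = i → v.1 = q j v.2) ∧
        (j ≠ i → j ≠ i + 1 → v.2 = 0)}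
      zero_mem' := ⟨fun _ => by simp, fun _ => by simp, fun _ _ => rfl⟩
      add_mem' := fun {v w} hv hw =>
        ⟨fun h => by simp [hv.1 h, hw.1 h], fun h => by simp [hv.2.1 h, hw.2.1 h],
          fun h h' => by simp [hv.2.2 h h', hw.2.2 h h']⟩
      smul_mem' := fun r v hv =>
        ⟨fun h => by simp [hv.1 h], fun h => by simp [hv.2.1 h],
          fun h h' => by simp [hv.2.2 h h']⟩ }
  let D (j k : ℤ) : P.X j × Q →ₗ[R] P.X k × Q :=
    (P.d j k).hom.prodMap (if j = i + 1 ∧ k = i then LinearMap.id else 0)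
  have hDC (j k : ℤ) (v) (hv : v ∈ C j) : D j k v ∈ C k := by
    refine ⟨?_, ?_, ?_⟩
    · rintro rfl
      simp [D, d_apply_d_apply]
    · rintro rfl
      by_cases h : j = k + 1
      · simpa [D, h] using hv.1 h
      · simp [D, d_eq_zero_of_ne P h, h]
    · intro h _
      simp [D, h]
  have hi1 : i + 1 ≠ i := by omega
  have e₁ : Nonempty (C i ≃ₗ[R] Q) := by
    refine ⟨LinearEquiv.ofBijective (LinearMap.snd R (P.X i) Q ∘ₗ (C i).subtype) ⟨?_, ?_⟩⟩
    · rintro ⟨⟨x, y⟩, hv⟩ ⟨⟨x', y'⟩, hv'⟩ (h : y = y')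
      have h1 : x = q i y := hv.2.1 rfl
      have h2 : x' = q i y' := hv'.2.1 rfl
      subst h
      subst h1
      subst h2
      rfl
    · intro y
      exact ⟨⟨(q i y, y), fun h => absurd h.symm hi1, fun _ => rfl, fun h => absurd rfl h⟩, rfl⟩
  have e₂ (j) (h : j ≠ i) (h' : j ≠ i + 1) : Nonempty (C j ≃ₗ[R] P.X j) := by
    refine ⟨LinearEquiv.ofBijective (LinearMap.fst R (P.X j) Q ∘ₗ (C j).subtype) ⟨?_, ?_⟩⟩
    · rintro ⟨⟨x, y⟩, hv⟩ ⟨⟨x', y'⟩, hv'⟩ (hx : x = x')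
      have h1 : y = 0 := hv.2.2 h h'
      have h2 : y' = 0 := hv'.2.2 h h'
      subst hx
      subst h1
      subst h2
      rfl
    · intro x
      exact ⟨⟨(x, 0), fun h₁ => absurd h₁ h', fun h₁ => absurd h₁ h, fun _ _ => rfl⟩, rfl⟩
  -- The pullback is the kernel of a map onto `P_i`, which splits because `P_i` is projective.
  have hproj : Module.Projective R (C (i + 1)) := by
    let f : P.X (i + 1) × Q →ₗ[R] P.X i := (P.d (i + 1) i).hom.coprod (-(q i))
    have hf : Function.Surjective f := fun x => by
      obtain ⟨y, z, h⟩ := hq x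
      exact ⟨(y, -z), by simp [f, h]⟩
    obtain ⟨g, hg⟩ := Module.projective_lifting_property f LinearMap.id hf
    have hmem (v) : v ∈ C (i + 1) ↔ f v = 0 := by
      simp only [f, LinearMap.coprod_apply, LinearMap.neg_apply, add_neg_eq_zero]
      exact ⟨fun h => h.1 rfl, fun h => ⟨fun _ => h, fun h => absurd h hi1, fun _ h => absurd rfl h⟩⟩
    have hfg (x) : f (g x) = x := LinearMap.congr_fun hg x
    let r : P.X (i + 1) × Q →ₗ[R] C (i + 1) := (LinearMap.id - g ∘ₗ f).codRestrict _ fun v =>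
      (hmem _).2 (by simp [hfg])
    refine Module.Projective.of_split (C (i + 1)).subtype r
      (LinearMap.ext fun v => Subtype.ext ?_)
    simp [r, (hmem _).1 v.2]
  refine ⟨moduleComplex (fun j => C j) (fun j k => (D j k).restrict (hDC j k)) ?_ ?_,
    ⟨?_, ?_⟩, ?_, e₁, fun j hj => e₂ j (by omega) (by omega)⟩
  · intro j k h
    ext v : 1
    have : ¬ (j = i + 1 ∧ k = i) := by omega
    refine Subtype.ext (Prod.ext ?_ ?_) <;> simp [D, d_eq_zero_of_ne P h, this]
  · intro j k l v
    refine Subtype.ext (Prod.ext (d_apply_d_apply P j k l v.1.1) ?_)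
    have : ¬ ((k = i + 1 ∧ l = i) ∧ (j = i + 1 ∧ k = i)) := by omega
    by_cases h : k = i + 1 ∧ l = i
    · have h' : ¬ (j = i + 1 ∧ k = i) := by omega
      simp [D, h']
    · simp [D, h]
  · intro j
    change Module.Projective R (C j)
    by_cases h : j = i
    · subst h
      exact Module.Projective.of_equiv e₁.some.symm
    · by_cases h' : j = i + 1
      · subst h'
        exact hproj
      · exact Module.Projective.of_equiv (e₂ j h h').some.symm
  · intro j hj
    have := hP.subsingleton j hj
    exact (e₂ j (by omega) (by omega)).some.toEquiv.subsingleton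
  · rintro j H _ _ ⟨T, a, p, ha, hp, hk⟩
    -- The new witness pairs an element of `T` with a cycle of the new complex above its image.
    let E : Submodule R (T × (P.X j × Q)) :=
      { carrier := {x | x.2 ∈ C j ∧ D j (j - 1) x.2 = 0 ∧ a x.1 = x.2.1}
        zero_mem' := ⟨zero_mem _, map_zero _, map_zero _⟩
        add_mem' := fun {x y} hx hy => ⟨add_mem hx.1 hy.1,
          by rw [Prod.snd_add, map_add, hx.2.1, hy.2.1, add_zero],
          by rw [Prod.fst_add, map_add, hx.2.2, hy.2.2]; rfl⟩
        smul_mem' := fun r x hx => ⟨Submodule.smul_mem _ r hx.1,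
          by rw [Prod.smul_snd, map_smul, hx.2.1, smul_zero],
          by rw [Prod.smul_fst, map_smul, hx.2.2]; rfl⟩ }
    refine hasHomology_moduleComplex
      ((LinearMap.snd R T (P.X j × Q) ∘ₗ E.subtype).codRestrict (C j) fun x => x.2.1)
      (p ∘ₗ LinearMap.fst R T (P.X j × Q) ∘ₗ E.subtype) ?_ ?_ ?_
    · rintro ⟨v, hv⟩
      constructor
      · intro h
        have h' : D j (j - 1) v = 0 := congrArg Subtype.val h
        obtain ⟨t, ht⟩ := (ha v.1).1 (congrArg Prod.fst h')
        exact ⟨⟨(t, v), hv, h', ht⟩, rfl⟩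
      · rintro ⟨⟨⟨t, v'⟩, hv', h', ht⟩, h⟩
        obtain rfl : v' = v := congrArg Subtype.val h
        exact Subtype.ext h'
    · intro h
      obtain ⟨t, rfl⟩ := hp h
      have ht := (ha (a t)).2 ⟨t, rfl⟩
      -- In degree `i` a cycle need not come from `Q`, but by the covering hypothesis it is
      -- homologous to some `q z`.
      by_cases h : j = i
      · subst h
        obtain ⟨y, z, hyz⟩ := hq (a t)
        have hz : (P.d j (j - 1)).hom (q j z) = 0 := by
          rw [← hyz, map_add, d_apply_d_apply, zero_add] at ht
          exact ht
        obtain ⟨t', ht'⟩ := (ha _).1 hz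
        refine ⟨⟨(t', (q j z, z)), ⟨fun h => absurd h.symm hi1, fun _ => rfl,
          fun h => absurd rfl h⟩, Prod.ext hz ?_, ht'⟩, ?_⟩
        · simp [D]
        · have : p (t - t') = 0 := (hk _).2 ⟨y, by rw [map_sub, ht', ← hyz, add_sub_cancel_right]⟩
          rw [map_sub, sub_eq_zero] at this
          exact this.symm
      · refine ⟨⟨(t, (a t, 0)), ⟨?_, fun h₁ => absurd h₁ h, fun _ _ => rfl⟩,
          Prod.ext ht (by simp [D]), rfl⟩, rfl⟩
        intro h₁
        obtain rfl : i = j - 1 := by omega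
        exact ht.trans (map_zero _).symm
    · rintro ⟨⟨t, v⟩, hv, hv', ht⟩
      change a t = v.1 at ht
      constructor
      · intro h
        obtain ⟨y, hy⟩ := (hk t).1 h
        suffices ∃ y' ∈ C (j + 1), D (j + 1) j y' = v by
          obtain ⟨y', hy', h⟩ := this
          exact ⟨⟨y', hy'⟩, Subtype.ext h⟩
        by_cases h : j = i
        · subst h
          refine ⟨(y, v.2), ⟨fun _ => ?_, fun h => absurd h hi1, fun _ h => absurd rfl h⟩,
            Prod.ext (hy.trans ht) ?_⟩
          · exact (hy.trans ht).trans (hv.2.1 rfl)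
          · simp [D]
        · have hv2 : v.2 = 0 := by
            by_cases h₁ : j = i + 1
            · obtain rfl : i = j - 1 := by omega
              simpa [D] using congrArg Prod.snd hv'
            · exact hv.2.2 h h₁
          -- Here `y` lies in `P_i`; it is exchanged for `q z`, which differs from it by a boundary
          -- and so has the same differential.
          by_cases h₁ : j + 1 = i
          · subst h₁
            obtain ⟨w, z, hwz⟩ := hq y
            refine ⟨(q _ z, z), ⟨fun h => absurd h.symm hi1, fun _ => rfl,
              fun h => absurd rfl h⟩, Prod.ext ?_ ?_⟩
            · rw [← ht, ← hy, ← hwz, map_add, d_apply_d_apply, zero_add]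
              rfl
            · simp [D, hv2]
          · refine ⟨(y, 0), ⟨fun h₂ => by omega, fun h₂ => absurd h₂ h₁, fun _ _ => rfl⟩,
              Prod.ext (hy.trans ht) ?_⟩
            simp [D, hv2]
      · rintro ⟨⟨y, hy⟩, h⟩
        have h' : D (j + 1) j y = v := congrArg Subtype.val h
        exact (hk t).2 ⟨y.1, (congrArg Prod.fst h').trans ht.symm⟩

/-- Over a Noetherian ring, a bounded complex of projective modules with finitely generated homology
can be replaced by one with finitely generated terms. -/
theorem IsBoundedProjective.exists_finite [IsNoetherianRing R] (hP : IsBoundedProjective P b s)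
    {H : ℤ → Type u} [∀ j, AddCommGroup (H j)] [∀ j, Module R (H j)]
    [∀ j, Module.Finite R (H j)] (hH : ∀ j, HasHomology P j (H j)) :
    ∃ P' : ChainComplex (ModuleCat.{u} R) ℤ, IsBoundedProjective P' b s ∧
      (∀ j, HasHomology P' j (H j)) ∧ ∀ j, Module.Finite R (P'.X j) := by
  suffices h : ∀ k : ℕ, ∃ P' : ChainComplex (ModuleCat.{u} R) ℤ, IsBoundedProjective P' b s ∧
      (∀ j, HasHomology P' j (H j)) ∧ ∀ j < b + k, Module.Finite R (P'.X j) by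
    obtain ⟨P', h₁, h₂, h₃⟩ := h (s + 1 - b).toNat
    refine ⟨P', h₁, h₂, fun j => ?_⟩
    by_cases hj : s < j
    · have := h₁.subsingleton j (Or.inr hj)
      infer_instance
    · exact h₃ j (by omega)
  intro k
  induction k with
  | zero =>
    refine ⟨P, hP, hH, fun j hj => ?_⟩
    have := hP.subsingleton j (Or.inl (by simpa using hj))
    infer_instance
  | succ k ih =>
    obtain ⟨P', h₁, h₂, h₃⟩ := ih
    have := h₃ (b + k - 1) (by omega)
    have hcover := (h₂ (b + k)).finite_quotient_range
    by_cases hs : b + k < s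
    -- A finite free module covers `P_i` modulo boundaries, for `i = b + k`; its map lifts to `P_i`
    -- and serves as the `Q` of the replacement.
    · obtain ⟨n, f, hf⟩ := Module.Finite.exists_fin' R
        (P'.X (b + k) ⧸ LinearMap.range (P'.d (b + k + 1) (b + k)).hom)
      obtain ⟨q, hq⟩ := Module.projective_lifting_property (Submodule.mkQ _) f
        (Submodule.mkQ_surjective _)
      obtain ⟨P'', g₁, g₂, ⟨e⟩, g₃⟩ := h₁.exists_replace (i := b + k) (by omega) hs _ q
        fun x => by
          obtain ⟨z, hz⟩ := hf (Submodule.mkQ _ x)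
          rw [← hq] at hz
          obtain ⟨y, hy⟩ := (Submodule.Quotient.eq _).1 hz.symm
          exact ⟨y, z, by rw [hy, sub_add_cancel]⟩
      refine ⟨P'', g₁, fun j => g₂ j _ (h₂ j), fun j hj => ?_⟩
      by_cases hj' : j = b + k
      · subst hj'
        exact Module.Finite.equiv e.symm
      · have := h₃ j (by omega)
        exact Module.Finite.equiv (g₃ j (by omega)).some.symm
    -- From degree `s` on there are no nonzero boundaries, so the term is already finitely generated
    -- and the complex does not grow past `s`.
    · refine ⟨P', h₁, h₂, fun j hj => ?_⟩
      by_cases hj' : j = b + k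
      · subst hj'
        have := h₁.subsingleton (b + k + 1) (Or.inr (by omega))
        have hbot : LinearMap.range (P'.d (b + k + 1) (b + k)).hom = ⊥ := by
          rw [LinearMap.range_eq_bot]
          exact Subsingleton.elim _ _
        exact Module.Finite.equiv (Submodule.quotEquivOfEqBot _ hbot)
      · exact h₃ j (by omega)

end FiniteGeneration

/-! ### Exact functors on finitely presented modules -/

section ExactFunctors

variable {A : Type u} [Ring A] {B : Type w} [Ring B]

/-- A finitely presented module as an object of the category of finitely presented modules. -/
abbrev fpObj (A : Type u) [Ring A] (M : Type u) [AddCommGroup M] [Module A M]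
    [hM : Module.FinitePresentation A M] : FPModuleCat A :=
  ⟨ModuleCat.of A M, hM⟩

variable (F : FPModuleCat A ⥤ FPModuleCat B)
  {M N K : Type u} [AddCommGroup M] [Module A M] [AddCommGroup N] [Module A N]
  [AddCommGroup K] [Module A K]

/-- The value of a functor on a finitely presented module. -/
abbrev mapModule (M : Type u) [AddCommGroup M] [Module A M] [Module.FinitePresentation A M] :
    Type w :=
  (F.obj (fpObj A M)).obj

section Map

variable [Module.FinitePresentation A M] [Module.FinitePresentation A N]
  [Module.FinitePresentation A K]

/-- The value of a functor on a linear map of finitely presented modules. -/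
def mapLinear (f : M →ₗ[A] N) : mapModule F M →ₗ[B] mapModule F N :=
  (F.map (ObjectProperty.homMk (ModuleCat.ofHom f) : fpObj A M ⟶ fpObj A N)).hom.hom

theorem mapLinear_id (x : mapModule F M) : mapLinear F (LinearMap.id : M →ₗ[A] M) x = x :=
  congrArg (fun f => f.hom.hom x) (F.map_id (fpObj A M))

theorem mapLinear_comp (g : N →ₗ[A] K) (f : M →ₗ[A] N) (x : mapModule F M) :
    mapLinear F (g ∘ₗ f) x = mapLinear F g (mapLinear F f x) :=
  congrArg (fun f => f.hom.hom x) (F.map_comp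
    (ObjectProperty.homMk (ModuleCat.ofHom f) : fpObj A M ⟶ fpObj A N)
    (ObjectProperty.homMk (ModuleCat.ofHom g) : fpObj A N ⟶ fpObj A K))

/-- A functor maps isomorphic modules to isomorphic modules. -/
def mapEquiv (e : M ≃ₗ[A] N) : mapModule F M ≃ₗ[B] mapModule F N :=
  LinearEquiv.ofLinearMap (mapLinear F e.toLinearMap) (mapLinear F e.symm.toLinearMap)
    (LinearMap.ext fun x => by
      rw [LinearMap.comp_apply, ← mapLinear_comp, LinearEquiv.comp_symm, mapLinear_id]; rfl)
    (LinearMap.ext fun x => by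
      rw [LinearMap.comp_apply, ← mapLinear_comp, LinearEquiv.symm_comp, mapLinear_id]; rfl)

variable {F}

theorem IsExactFunctor.shortExact (hF : IsExactFunctor F) (f : M →ₗ[A] N) (g : N →ₗ[A] K)
    (hf : Function.Injective f) (hfg : Function.Exact f g) (hg : Function.Surjective g) :
    Function.Injective (mapLinear F f) ∧ Function.Exact (mapLinear F f) (mapLinear F g) ∧
      Function.Surjective (mapLinear F g) :=
  hF (ObjectProperty.homMk (ModuleCat.ofHom f) : fpObj A M ⟶ fpObj A N)
    (ObjectProperty.homMk (ModuleCat.ofHom g) : fpObj A N ⟶ fpObj A K) hf hfg hg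

/-- For `M = 0` the sequence with two identity maps is short exact; its image is exact only if `F M
= 0`. -/
theorem IsExactFunctor.subsingleton (hF : IsExactFunctor F) (M : Type u) [AddCommGroup M]
    [Module A M] [Module.FinitePresentation A M] [Subsingleton M] :
    Subsingleton (mapModule F M) := by
  have h := (hF.shortExact (LinearMap.id : M →ₗ[A] M) LinearMap.id Function.injective_id
    (fun y => ⟨fun h => ⟨y, rfl⟩, fun _ => Subsingleton.elim _ _⟩) Function.surjective_id).2.1
  refine subsingleton_of_forall_eq 0 fun x => ?_
  have := (h x).2 ⟨x, mapLinear_id F x⟩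
  rwa [mapLinear_id] at this

/-- Additivity of `F` is not assumed; the zero map is preserved because it factors through the zero
module. -/
theorem IsExactFunctor.mapLinear_zero (hF : IsExactFunctor F) :
    mapLinear F (0 : M →ₗ[A] N) = 0 := by
  have := hF.subsingleton PUnit.{u + 1}
  ext x
  have h : (0 : M →ₗ[A] N) = (0 : PUnit.{u + 1} →ₗ[A] N) ∘ₗ (0 : M →ₗ[A] PUnit.{u + 1}) := rfl
  rw [h, mapLinear_comp, Subsingleton.elim (mapLinear F (0 : M →ₗ[A] PUnit.{u + 1}) x) 0,
    map_zero]
  rfl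

/-- An exact functor preserves binary products. -/
theorem IsExactFunctor.nonempty_prod_equiv (hF : IsExactFunctor F) :
    Nonempty (mapModule F (M × N) ≃ₗ[B] mapModule F M × mapModule F N) := by
  have h := hF.shortExact (LinearMap.inl A M N) (LinearMap.snd A M N) LinearMap.inl_injective
    Function.Exact.inl_snd Prod.snd_surjective
  have h₁ (x : mapModule F M) : mapLinear F (LinearMap.fst A M N)
      (mapLinear F (LinearMap.inl A M N) x) = x := by
    rw [← mapLinear_comp, LinearMap.fst_comp_inl, mapLinear_id]
  have h₂ (x : mapModule F M) : mapLinear F (LinearMap.snd A M N)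
      (mapLinear F (LinearMap.inl A M N) x) = 0 := by
    rw [← mapLinear_comp, LinearMap.snd_comp_inl, hF.mapLinear_zero, LinearMap.zero_apply]
  refine ⟨LinearEquiv.ofBijective
    ((mapLinear F (LinearMap.fst A M N)).prod (mapLinear F (LinearMap.snd A M N))) ⟨?_, ?_⟩⟩
  · refine (injective_iff_map_eq_zero _).2 fun z hz => ?_
    obtain ⟨x, rfl⟩ := (h.2.1 z).1 (congrArg Prod.snd hz)
    have := congrArg Prod.fst hz
    rw [show x = 0 from (h₁ x).symm.trans this, map_zero]
  · rintro ⟨x, y⟩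
    obtain ⟨z, rfl⟩ := h.2.2 y
    refine ⟨z + mapLinear F (LinearMap.inl A M N)
      (x - mapLinear F (LinearMap.fst A M N) z), Prod.ext ?_ ?_⟩
    · simp [h₁]
    · simp [h₂]

/-- An exact functor preserves finite powers. -/
theorem IsExactFunctor.nonempty_pi_equiv (hF : IsExactFunctor F) (n : ℕ) :
    Nonempty (mapModule F (Fin n → M) ≃ₗ[B] (Fin n → mapModule F M)) := by
  induction n with
  | zero =>
    have := hF.subsingleton (Fin 0 → M)
    exact ⟨LinearEquiv.ofBijective 0
      ⟨Function.injective_of_subsingleton _, fun x => ⟨0, Subsingleton.elim _ _⟩⟩⟩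
  | succ n ih =>
    exact ⟨mapEquiv F (Fin.consLinearEquiv A fun _ : Fin (n + 1) => M).symm ≪≫ₗ
      hF.nonempty_prod_equiv.some ≪≫ₗ
      LinearEquiv.prodCongr (LinearEquiv.refl B _) ih.some ≪≫ₗ
      Fin.consLinearEquiv B fun _ : Fin (n + 1) => mapModule F M⟩

/-- A functor that induces a functor between stable categories preserves projective modules. -/
theorem IsExactFunctor.projective (hF : IsExactFunctor F)
    (hst : ∀ (X Y : FPModuleCat A) (f g : X ⟶ Y),
      stableRel A f g → stableRel B (F.map f) (F.map g)) [hM : Module.Projective A M] :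
    Module.Projective B (mapModule F M) := by
  -- The identity of a projective module is stably zero, so its image factors through a projective
  -- module.
  obtain ⟨Q, a, b, hQ, hab⟩ := hst (fpObj A M) (fpObj A M) (𝟙 _)
    (ObjectProperty.homMk (ModuleCat.ofHom (0 : M →ₗ[A] M)))
    ⟨fpObj A M, 𝟙 _, 𝟙 _, hM, by rw [Category.comp_id]; ext x; exact sub_zero x⟩
  refine Module.Projective.of_split a.hom.hom b.hom.hom (LinearMap.ext fun x => ?_)
  have h : mapLinear F (LinearMap.id : M →ₗ[A] M) x - mapLinear F (0 : M →ₗ[A] M) x =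
      b.hom.hom (a.hom.hom x) := congrArg (fun f => f.hom.hom x) hab
  rw [mapLinear_id, hF.mapLinear_zero, LinearMap.zero_apply, sub_zero] at h
  exact h.symm

end Map

section Noetherian

variable [IsNoetherianRing A] {F} [Module.FinitePresentation A M] [Module.FinitePresentation A N]
  [Module.FinitePresentation A K]

theorem Module.FinitePresentation.of_submodule (S : Submodule A M) :
    Module.FinitePresentation A S :=
  Module.finitePresentation_of_finite A S

theorem Module.FinitePresentation.of_quotient (S : Submodule A M) :
    Module.FinitePresentation A (M ⧸ S) :=
  Module.finitePresentation_of_finite A (M ⧸ S)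

theorem IsExactFunctor.injective (hF : IsExactFunctor F) {f : M →ₗ[A] N}
    (hf : Function.Injective f) : Function.Injective (mapLinear F f) := by
  have := Module.FinitePresentation.of_quotient (LinearMap.range f)
  exact (hF.shortExact f (LinearMap.range f).mkQ hf (LinearMap.exact_map_mkQ_range f)
    (Submodule.mkQ_surjective _)).1

theorem IsExactFunctor.surjective (hF : IsExactFunctor F) {f : M →ₗ[A] N}
    (hf : Function.Surjective f) : Function.Surjective (mapLinear F f) := by
  have := Module.FinitePresentation.of_submodule (LinearMap.ker f)
  exact (hF.shortExact (LinearMap.ker f).subtype f Subtype.val_injective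
    f.exact_subtype_ker_map hf).2.2

/-- Over a Noetherian ring kernels and images are again finitely presented, so an exact pair can be
cut into short exact sequences to which `F` applies. -/
theorem IsExactFunctor.exact (hF : IsExactFunctor F) {f : M →ₗ[A] N} {g : N →ₗ[A] K}
    (h : Function.Exact f g) : Function.Exact (mapLinear F f) (mapLinear F g) := by
  have := Module.FinitePresentation.of_submodule (LinearMap.ker g)
  have := Module.FinitePresentation.of_submodule (LinearMap.range g)
  let f' : M →ₗ[A] LinearMap.ker g := f.codRestrict _ fun x => (h _).2 ⟨x, rfl⟩
  have hf' : Function.Surjective f' := fun ⟨y, hy⟩ => by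
    obtain ⟨x, rfl⟩ := (h y).1 hy
    exact ⟨x, rfl⟩
  have h' := (hF.shortExact (LinearMap.ker g).subtype g.rangeRestrict Subtype.val_injective
    (fun y => ⟨fun hy => ⟨⟨y, congrArg Subtype.val hy⟩, rfl⟩, fun ⟨x, hx⟩ => by
      rw [← hx]; exact Subtype.ext x.2⟩) g.surjective_rangeRestrict).2.1
  have hf (x) : mapLinear F f x = mapLinear F (LinearMap.ker g).subtype (mapLinear F f' x) := by
    rw [← mapLinear_comp]; rfl
  have hg (y) : mapLinear F g y = mapLinear F (LinearMap.range g).subtype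
      (mapLinear F g.rangeRestrict y) := by
    rw [← mapLinear_comp]; rfl
  intro y
  rw [hg, map_eq_zero_iff _ (hF.injective Subtype.val_injective), h' y]
  constructor
  · rintro ⟨z, rfl⟩
    obtain ⟨x, rfl⟩ := hF.surjective hf' z
    exact ⟨x, hf x⟩
  · rintro ⟨x, rfl⟩
    exact ⟨_, (hf x).symm⟩

/-- Exact functors that preserve projective modules can be applied to bounded complexes of finitely
presented projective modules. -/
theorem IsBoundedProjective.exists_map (hF : IsExactFunctor F)
    (hst : ∀ (X Y : FPModuleCat A) (f g : X ⟶ Y),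
      stableRel A f g → stableRel B (F.map f) (F.map g))
    {P : ChainComplex (ModuleCat.{u} A) ℤ} {b s : ℤ} (hP : IsBoundedProjective P b s)
    (hfin : ∀ j, Module.Finite A (P.X j)) {H : ℤ → Type u} [∀ j, AddCommGroup (H j)]
    [∀ j, Module A (H j)] [∀ j, Module.FinitePresentation A (H j)]
    (hH : ∀ j, HasHomology P j (H j)) :
    ∃ P' : ChainComplex (ModuleCat.{w} B) ℤ, IsBoundedProjective P' b s ∧
      ∀ j, HasHomology P' j (mapModule F (H j)) := by
  have := hP.projective
  have (j : ℤ) : Module.FinitePresentation A (P.X j) := Module.finitePresentation_of_finite A _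
  refine ⟨moduleComplex (fun j => mapModule F (P.X j)) (fun i j => mapLinear F (P.d i j).hom)
    ?_ ?_, ⟨fun j => hF.projective hst (M := P.X j), fun j hj => ?_⟩, fun j => ?_⟩
  · intro i j h
    rw [d_eq_zero_of_ne P h, hF.mapLinear_zero]
  · intro i j k x
    rw [← mapLinear_comp, show (P.d j k).hom ∘ₗ (P.d i j).hom = 0 from
      LinearMap.ext fun x => d_apply_d_apply P i j k x, hF.mapLinear_zero, LinearMap.zero_apply]
  · have := hP.subsingleton j hj
    exact hF.subsingleton (P.X j)
  -- The actual cycles serve as witness because, unlike an arbitrary `T`, they are finitely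
  -- presented.
  · obtain ⟨p, hp, hk⟩ := (hH j).exists_surjective
    let Z := LinearMap.ker (P.d j (j - 1)).hom
    have := Module.FinitePresentation.of_submodule Z
    let c : P.X (j + 1) →ₗ[A] Z := (P.d (j + 1) j).hom.codRestrict Z
      fun y => d_apply_d_apply P (j + 1) j (j - 1) y
    refine hasHomology_moduleComplex (mapLinear F Z.subtype) (mapLinear F p)
      (hF.exact (LinearMap.exact_subtype_ker_map _)) (hF.surjective hp) fun t => ?_
    have hc : Function.Exact c p := fun z => (hk z).trans
      ⟨fun ⟨y, hy⟩ => ⟨y, Subtype.ext hy⟩, fun ⟨y, hy⟩ => ⟨y, congrArg Subtype.val hy⟩⟩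
    have hd (y) : mapLinear F (P.d (j + 1) j).hom y =
        mapLinear F Z.subtype (mapLinear F c y) := by
      rw [← mapLinear_comp]; rfl
    rw [hF.exact hc t]
    refine exists_congr fun y => ?_
    rw [hd, (hF.injective Z.subtype_injective).eq_iff]

end Noetherian

end ExactFunctors

/-! ### From stable isomorphism to isomorphism up to projectives -/

section StableIsomorphism

variable {R : Type u} [Ring R]

/-- Stably isomorphic modules become isomorphic after adding projective modules. -/
theorem exists_prod_equiv_of_stableRel {X Y : FPModuleCat R} (f : X ⟶ Y) (g : Y ⟶ X)
    (hfg : stableRel R (f ≫ g) (𝟙 X)) (hgf : stableRel R (g ≫ f) (𝟙 Y)) :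
    ∃ Q W : ModuleCat.{u} R, Module.Projective R Q ∧ Module.Projective R W ∧
      Nonempty ((Y.obj × Q) ≃ₗ[R] (X.obj × W)) := by
  obtain ⟨Q, a, b, hQ, hab⟩ := hfg
  obtain ⟨Q', a', b', hQ', hab'⟩ := hgf
  replace hab (x : X.obj) : g.hom.hom (f.hom.hom x) - x = b.hom.hom (a.hom.hom x) :=
    congrArg (fun f => f.hom.hom x) hab
  replace hab' (x : Y.obj) : f.hom.hom (g.hom.hom x) - x = b'.hom.hom (a'.hom.hom x) :=
    congrArg (fun f => f.hom.hom x) hab'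
  generalize f.hom.hom = f at *
  generalize g.hom.hom = g at *
  generalize a.hom.hom = a at *
  generalize b.hom.hom = b at *
  generalize a'.hom.hom = a' at *
  generalize b'.hom.hom = b' at *
  -- As `g f - 1 = b a`, the map `r = (g, -b)` retracts `i = (f, a)`, so `Y ⊕ Q ≅ X ⊕ ker r`.
  let i : X.obj →ₗ[R] Y.obj × Q.obj := f.prod a
  let r : Y.obj × Q.obj →ₗ[R] X.obj := g.coprod (-b)
  have hri (x) : r (i x) = x := by
    simp [r, i, ← hab]
  let π : Y.obj × Q.obj →ₗ[R] LinearMap.ker r :=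
    (LinearMap.id - i ∘ₗ r).codRestrict _ fun v => by simp [hri]
  have hπ (v) : (π v : Y.obj × Q.obj) = v - i (r v) := rfl
  have hπ' (w : LinearMap.ker r) : π w = w :=
    Subtype.ext (by rw [hπ, LinearMap.mem_ker.1 w.2, map_zero, sub_zero])
  refine ⟨Q.obj, ModuleCat.of R (LinearMap.ker r), hQ, ?_,
    ⟨LinearEquiv.ofBijective (r.prod π) ⟨?_, ?_⟩⟩⟩
  -- The kernel is projective because `1 - i r`, which is the identity on it, factors through `Q' ⊕
  -- Q ⊕ Q`: its first component is `-b' a' y + f b q`, its second `q - a r (y, q)`.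
  · let c : Y.obj × Q.obj →ₗ[R] Q'.obj × Q.obj × Q.obj :=
      (a' ∘ₗ LinearMap.fst R _ _).prod ((LinearMap.snd R _ _).prod
        (LinearMap.snd R _ _ - a ∘ₗ r))
    let e : Q'.obj × Q.obj × Q.obj →ₗ[R] Y.obj × Q.obj :=
      (LinearMap.prod (-b') 0).coprod ((LinearMap.prod (f ∘ₗ b) 0).coprod (LinearMap.inr R _ _))
    have hec (v) : e (c v) = v - i (r v) := by
      refine Prod.ext ?_ ?_
      · simp [e, c, i, r, ← hab']
        abel
      · simp [e, c, i, r]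
    refine Module.Projective.of_split (M := Q'.obj × Q.obj × Q.obj) (c ∘ₗ Submodule.subtype _)
      (π ∘ₗ e) (LinearMap.ext fun w => ?_)
    change π (e (c w)) = w
    rw [hec, ← hπ, hπ', hπ']
  · refine (injective_iff_map_eq_zero _).2 fun v hv => ?_
    have h₁ : r v = 0 := congrArg Prod.fst hv
    have h₂ : π v = 0 := congrArg Prod.snd hv
    have h₃ : v - i (r v) = 0 := congrArg Subtype.val h₂
    rwa [h₁, map_zero, sub_zero] at h₃
  · rintro ⟨x, w⟩
    refine ⟨i x + w, Prod.ext ?_ (Subtype.ext ?_)⟩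
    · change r (i x + w) = x
      rw [map_add, hri, LinearMap.mem_ker.1 w.2, add_zero]
    · change (π (i x + w) : Y.obj × Q.obj) = w
      rw [hπ, map_add, hri, LinearMap.mem_ker.1 w.2, add_zero, add_sub_cancel_left]

/-- Isomorphic objects of the stable category become isomorphic after adding projective modules. -/
theorem exists_prod_equiv_of_stable_iso {X Y : FPModuleCat R}
    (e : (Quotient.functor (stableRel R)).obj X ≅ (Quotient.functor (stableRel R)).obj Y) :
    ∃ Q W : ModuleCat.{u} R, Module.Projective R Q ∧ Module.Projective R W ∧
      Nonempty ((Y.obj × Q) ≃ₗ[R] (X.obj × W)) := by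
  have := stableRel_congruence R
  obtain ⟨f, hf⟩ := (Quotient.functor (stableRel R)).map_surjective e.hom
  obtain ⟨g, hg⟩ := (Quotient.functor (stableRel R)).map_surjective e.inv
  refine exists_prod_equiv_of_stableRel f g ?_ ?_
  · refine (Quotient.functor_map_eq_iff (stableRel R) _ _).1 ?_
    rw [Functor.map_comp, hf, hg, e.hom_inv_id, CategoryTheory.Functor.map_id]
  · refine (Quotient.functor_map_eq_iff (stableRel R) _ _).1 ?_
    rw [Functor.map_comp, hf, hg, e.inv_hom_id, CategoryTheory.Functor.map_id]

end StableIsomorphism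

/-! ### Quasi-projective dimension in terms of bounds -/

section QuasiProjectiveDimension

attribute [local instance] Abelian.hasFiniteBiproducts

variable {R : Type u} [Ring R] {P : ChainComplex (ModuleCat.{u} R) ℤ}

theorem HasHomology.subsingleton {j : ℤ} {H : Type u} [AddCommGroup H] [Module R H]
    (h : HasHomology P j H) [Subsingleton (P.X j)] : Subsingleton H := by
  obtain ⟨T, a, p, ha, hp, hk⟩ := h
  refine subsingleton_of_forall_eq 0 fun x => ?_
  obtain ⟨t, rfl⟩ := hp x
  exact (hk t).2 ⟨0, Subsingleton.elim _ _⟩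

theorem not_subsingleton_fin_fun {M : Type*} (hM : ¬ Subsingleton M) {n : ℕ} (hn : n ≠ 0) :
    ¬ Subsingleton (Fin n → M) := by
  have := not_subsingleton_iff_nontrivial.1 hM
  have : Nonempty (Fin n) := ⟨⟨0, Nat.pos_of_ne_zero hn⟩⟩
  exact not_subsingleton _

theorem projective_fin_fun (M : Type*) [AddCommGroup M] [Module R M] [Module.Projective R M]
    (n : ℕ) : Module.Projective R (Fin n → M) := by
  classical
  exact Module.Projective.of_equiv
    (DFinsupp.linearEquivFunOnFintype (R := R) (M := fun _ : Fin n => M))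

theorem hasHomology_fin_fun_iff {M : ModuleCat.{u} R} {j : ℤ} {n : ℕ} :
    HasHomology P j (Fin n → M) ↔ Nonempty (P.homology j ≅ ⨁ fun _ : Fin n => M) :=
  hasHomology_iff.trans
    ⟨fun ⟨e⟩ => ⟨e ≪≫ (ModuleCat.biproductIsoPi fun _ : Fin n => M).symm⟩,
      fun ⟨e⟩ => ⟨e ≪≫ ModuleCat.biproductIsoPi fun _ : Fin n => M⟩⟩

/-- The bounds need not be attained: the true supremum is at most `s` and the top homology degree at
least `h`, so the difference can only be smaller. -/
theorem IsBoundedProjective.qpdim_le {b s : ℤ} (hP : IsBoundedProjective P b s)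
    {M : ModuleCat.{u} R} (hM : ¬ IsZero M) {n : ℤ → ℕ}
    (hH : ∀ j, HasHomology P j (Fin (n j) → M)) {h : ℤ} (hn : n h ≠ 0) {k : ℕ} (hk : s - h = k) :
    qpdim M ≤ k := by
  have hM' : ¬ Subsingleton M := fun h => hM (ModuleCat.isZero_iff_subsingleton.2 h)
  have hX (j) (hj : j < b ∨ s < j) : IsZero (P.X j) :=
    ModuleCat.isZero_iff_subsingleton.2 (hP.subsingleton j hj)
  have hhom (j) (hj : IsZero (P.X j)) : IsZero (P.homology j) := by
    have := ModuleCat.isZero_iff_subsingleton.1 hj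
    have := (hH j).subsingleton
    exact (ModuleCat.isZero_iff_subsingleton.2 this).of_iso (hasHomology_iff.1 (hH j)).some
  have hne : ¬ IsZero (P.homology h) := fun h0 => not_subsingleton_fin_fun hM' hn
    (ModuleCat.isZero_iff_subsingleton.1 (h0.of_iso (hasHomology_iff.1 (hH h)).some.symm))
  have hle (j) (hj : ¬ IsZero (P.X j)) : j ≤ s := not_lt.1 fun h => hj (hX j (Or.inr h))
  obtain ⟨s', hs', hs''⟩ := Int.exists_greatest_of_bdd (P := fun j => ¬ IsZero (P.X j))
    ⟨s, hle⟩ ⟨h, fun h0 => hne (hhom h h0)⟩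
  obtain ⟨h', hh', hh''⟩ := Int.exists_greatest_of_bdd (P := fun j => ¬ IsZero (P.homology j))
    ⟨s, fun j hj => hle j fun h0 => hj (hhom j h0)⟩ ⟨h, hne⟩
  have h₁ : h ≤ h' := hh'' h hne
  have h₂ : h' ≤ s' := hs'' h' fun h0 => hh' (hhom h' h0)
  have h₃ : s' ≤ s := hle s' hs'
  rw [qpdim, if_neg hM]
  refine le_trans (sInf_le (a := ((s' - h').toNat : ℕ∞)) ⟨P, s', h', (s' - h').toNat,
    ⟨⟨b, fun i hi => hX i (Or.inl hi)⟩, fun i => ?_,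
    n, ⟨h, hn⟩, fun j => hasHomology_fin_fun_iff.1 (hH j)⟩, ⟨hs', hs''⟩, ⟨hh', hh''⟩, ?_,
    rfl⟩) ?_
  · have := hP.projective i
    exact (IsProjective.iff_projective (P.X i)).1 this
  · omega
  · exact Nat.cast_le.2 (by omega)

theorem IsQuasiProjectiveResolution.exists_isBoundedProjective {N : ModuleCat.{u} R}
    (hN : ¬ IsZero N) (hP : IsQuasiProjectiveResolution N P) {s h : ℤ} (hs : IsSupOf P s)
    (hh : IsHSupOf P h) : ∃ (b : ℤ) (n : ℤ → ℕ), IsBoundedProjective P b s ∧ n h ≠ 0 ∧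
      (∀ j, j < b ∨ s < j → n j = 0) ∧ ∀ j, HasHomology P j (Fin (n j) → N) := by
  obtain ⟨b, hb⟩ := hP.boundedBelow
  obtain ⟨n, -, hn⟩ := hP.homology_iso
  have hH (j) : HasHomology P j (Fin (n j) → N) := hasHomology_fin_fun_iff.2 (hn j)
  have hP' : IsBoundedProjective P b s := by
    refine ⟨fun j => (IsProjective.iff_projective (P.X j)).2 (hP.projective j), ?_⟩
    rintro j (hj | hj)
    · exact ModuleCat.isZero_iff_subsingleton.1 (hb j hj)
    · exact ModuleCat.isZero_iff_subsingleton.1 (by_contra fun h => (hs.2 h).not_gt hj)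
  refine ⟨b, n, hP', fun h0 => hh.1 ?_, fun j hj => by_contra fun hj' => ?_, hH⟩
  · have hsub : Subsingleton (Fin (n h) → N) := by
      rw [h0]
      infer_instance
    exact (ModuleCat.isZero_iff_subsingleton.2 hsub).of_iso (hasHomology_iff.1 (hH h)).some
  · have := hP'.subsingleton j hj
    exact not_subsingleton_fin_fun (fun h => hN (ModuleCat.isZero_iff_subsingleton.2 h)) hj'
      (hH j).subsingleton

theorem qpdim_eq_zero_of_isZero {M : ModuleCat.{u} R} (hM : IsZero M) : qpdim M = 0 :=
  if_pos hM

/-- A nonzero projective module placed in degree 0 resolves itself; the complex arises by adding it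
to the zero complex. -/
theorem qpdim_eq_zero_of_projective {M : ModuleCat.{u} R} (hM : Module.Projective R M) :
    qpdim M = 0 := by
  by_cases hM₀ : IsZero M
  · exact qpdim_eq_zero_of_isZero hM₀
  let n (j : ℤ) : ℕ := if j = 0 then 1 else 0
  have hO : IsBoundedProjective (moduleComplex (R := R) (fun _ => PUnit.{u + 1}) (fun _ _ => 0)
      (fun _ _ _ => rfl) fun _ _ _ _ => rfl) 0 0 :=
    ⟨fun _ => inferInstanceAs (Module.Projective R PUnit.{u + 1}),
      fun _ _ => inferInstanceAs (Subsingleton PUnit.{u + 1})⟩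
  obtain ⟨P, hP, hH⟩ := hO.exists_prod (H := fun _ => PUnit.{u + 1})
    (W := fun j => Fin (n j) → M)
    (fun j => hasHomology_moduleComplex LinearMap.id LinearMap.id (fun x => ⟨fun _ => ⟨x, rfl⟩,
      fun _ => rfl⟩) Function.surjective_id fun t => ⟨fun _ => ⟨t, rfl⟩, fun _ => rfl⟩)
    (fun j => projective_fin_fun _ _) fun j hj => by
      have : n j = 0 := if_neg (by omega)
      rw [this]
      infer_instance
  have := hP.qpdim_le hM₀ (n := n) (fun j => (hH j).congr
    (LinearEquiv.uniqueProd (R := R) (M := Fin (n j) → M) (M₂ := PUnit.{u + 1}))) (h := 0) (k := 0)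
    (by simp [n]) (by simp)
  simpa using this

/-- Maps into a product are pairs of maps. -/
def piProdEquiv (R : Type*) [Ring R] (ι M N : Type*) [AddCommGroup M] [Module R M]
    [AddCommGroup N] [Module R N] : (ι → M × N) ≃ₗ[R] (ι → M) × (ι → N) where
  toFun f := (fun i => (f i).1, fun i => (f i).2)
  invFun p i := (p.1 i, p.2 i)
  map_add' _ _ := rfl
  map_smul' _ _ := rfl
  left_inv _ := rfl
  right_inv _ := rfl

end QuasiProjectiveDimension

/-! ### Transporting resolutions and conclusion -/

section StableEquivalence

variable {A : Type u} [Ring A] {B : Type w} [Ring B]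

/-- The quasi-projective dimension does not grow along an exact functor that respects stable
equality, up to stable isomorphism of the image. -/
theorem IsExactFunctor.qpdim_le (hA : IsQuasiFrobenius A) (hB : IsQuasiFrobenius B)
    {F : FPModuleCat A ⥤ FPModuleCat B} (hF : IsExactFunctor F)
    (hst : ∀ (X Y : FPModuleCat A) (f g : X ⟶ Y),
      stableRel A f g → stableRel B (F.map f) (F.map g)) (N : FPModuleCat A)
    {M Q W : ModuleCat.{w} B} [Module.Projective B Q] [Module.Projective B W]
    (e : ((F.obj N).obj × Q) ≃ₗ[B] (M × W)) : qpdim M ≤ qpdim N.obj := by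
  have := hA.isNoetherianRing
  have hNfp : Module.FinitePresentation A N.obj := N.property
  by_cases hM : IsZero M
  · rw [qpdim_eq_zero_of_isZero hM]
    exact zero_le
  -- The dimension of `N = 0` is 0 by convention, with no resolution to transport; but then `M` is a
  -- summand of `Q`, hence projective.
  by_cases hN : IsZero N.obj
  · have := ModuleCat.isZero_iff_subsingleton.1 hN
    have h₀ : Subsingleton (F.obj N).obj := hF.subsingleton N.obj
    have hM' : Module.Projective B M := by
      refine Module.Projective.of_split
        (LinearMap.snd B _ _ ∘ₗ e.symm.toLinearMap ∘ₗ LinearMap.inl B M W)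
        (LinearMap.fst B M W ∘ₗ e.toLinearMap ∘ₗ LinearMap.inr B _ _) (LinearMap.ext fun x => ?_)
      have : ((0, (e.symm (x, 0)).2) : (F.obj N).obj × Q) = e.symm (x, 0) :=
        Prod.ext (Subsingleton.elim _ _) rfl
      simp [this]
    rw [qpdim_eq_zero_of_projective hM']
    exact zero_le
  rw [qpdim.eq_def N.obj, if_neg hN]
  refine le_sInf ?_
  rintro _ ⟨P, s, h, k, hP, hs, hh, hk, rfl⟩
  obtain ⟨b, n, hP, hn, hn₀, hH⟩ := hP.exists_isBoundedProjective hN hs hh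
  obtain ⟨P₁, hP₁, hH₁, hfin⟩ := hP.exists_finite hH
  obtain ⟨P₂, hP₂, hH₂⟩ := hP₁.exists_map hF hst hfin hH₁
  obtain ⟨P₃, hP₃, hH₃⟩ := hP₂.exists_prod hH₂ (W := fun j => Fin (n j) → Q)
    (fun j => projective_fin_fun _ _) fun j hj => by
      rw [hn₀ j hj]
      infer_instance
  obtain ⟨P₄, hP₄, hH₄⟩ := hP₃.exists_of_prod (H := fun j => Fin (n j) → M)
    (W := fun j => Fin (n j) → W)
    (fun j => (hH₃ j).congr (
      LinearEquiv.prodCongr (hF.nonempty_pi_equiv (n j)).some (LinearEquiv.refl B _) ≪≫ₗ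
      (piProdEquiv B (Fin (n j)) (F.obj N).obj Q).symm ≪≫ₗ
      LinearEquiv.piCongrRight (fun _ => e) ≪≫ₗ piProdEquiv B (Fin (n j)) M W))
    (fun j => projective_fin_fun _ _) fun j => (hB _).1 (projective_fin_fun _ _)
  exact hP₄.qpdim_le hM hH₄ hn hk

end StableEquivalence

theorem proposition4p5 {A : Type*} [Ring A] {B : Type*} [Ring B]
    (hA : IsQuasiFrobenius A) (hB : IsQuasiFrobenius B)
    (F : FPModuleCat A ⥤ FPModuleCat B) (hF : IsExactFunctor F)
    (hst : InducesStableEquivalence F) :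
    qgldim B ≤ qgldim A := by
  obtain ⟨hst, hG⟩ := hst
  refine iSup_le fun M => ?_
  obtain ⟨N, ⟨e⟩⟩ := hG.essSurj.mem_essImage ((Quotient.functor (stableRel B)).obj M)
  obtain ⟨Q, W, hQ, hW, ⟨e'⟩⟩ := exists_prod_equiv_of_stable_iso (X := M) (Y := F.obj N.as) e.symm
  exact (hF.qpdim_le hA hB hst N.as e').trans (le_iSup (fun N : FPModuleCat A => qpdim N.obj) N.as)
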